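/- Let $\mathbf{Sol}$ be $\mathbb{R}^3$ with coordinates $(x,y,z)$ and the Riemannian metric $ds^2=e^{2z}\,dx^2+e^{-2z}\,dy^2+dz^2$. A geodesic is a curve that satisfies the geodesic equation of the Levi-Civita connection of this metric; geodesic segments are not required to be shortest. A geodesic triangle consists of three different points $A_1,A_2,A_3\in\mathbf{Sol}$ that do not lie on a common geodesic, together with geodesic segments joining them pairwise (the sides). Its interior angle $\omega_i\in[0,\pi]$ at $A_i$ is the Riemannian angle between the tangent vectors at $A_i$ of the two sides that meet there, both oriented away from $A_i$. **Theorem.** The sum of the interior angles of a geodesic triangle of $\mathbf{Sol}$ can be larger than, less than or equal to $\pi$. That is, there is a geodesic triangle in $\mathbf{Sol}$ with $\omega_1+\omega_2+\omega_3>\pi$, there is one with $\omega_1+\omega_2+\omega_3<\pi$, and there is one with $\omega_1+\omega_2+\omega_3=\pi$. -/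

import Mathlib

namespace SolGeometry

/-- The underlying space of `Sol`, in its global coordinates `(x, y, z) = (p 0, p 1, p 2)`. The
points `(1 : x : y : z)` of the projective model are exactly the points of this space. -/
abbrev Sol : Type := Fin 3 → ℝ

/-- The metric tensor `(g_ij)` of `Sol` at the point `p`, that is
`ds² = e^(2z) dx² + e^(-2z) dy² + dz²`. -/
noncomputable def metric (p : Sol) : Matrix (Fin 3) (Fin 3) ℝ :=
  Matrix.diagonal ![Real.exp (2 * p 2), Real.exp (-2 * p 2), 1]

/-- The partial derivative `∂_i g_jl` of the metric tensor at `p`. -/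
noncomputable def metricDeriv (p : Sol) (i j l : Fin 3) : ℝ :=
  fderiv ℝ (fun q : Sol => metric q j l) p (Pi.single i 1)

/-- The Christoffel symbols `Γ^k_ij = (1/2) ∑_l g^kl (∂_i g_jl + ∂_j g_il - ∂_l g_ij)` of the
Levi-Civita connection of the metric. -/
noncomputable def christoffel (p : Sol) (k i j : Fin 3) : ℝ :=
  1 / 2 * ∑ l, (metric p)⁻¹ k l *
    (metricDeriv p i j l + metricDeriv p j i l - metricDeriv p l i j)

/-- `γ : ℝ → Sol` is an (affinely parametrized, complete) geodesic of `Sol`: it is of class `C²` and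
`γ''^k + ∑_{i,j} Γ^k_ij(γ) γ'^i γ'^j = 0` for every `k`. -/
def IsGeodesic (γ : ℝ → Sol) : Prop :=
  ContDiff ℝ 2 γ ∧
    ∀ (t : ℝ) (k : Fin 3),
      deriv (deriv γ) t k + ∑ i, ∑ j, christoffel (γ t) k i j * deriv γ t i * deriv γ t j = 0

/-- The Riemannian inner product of the tangent vectors `u`, `v` at `p`. -/
noncomputable def metricInner (p : Sol) (u v : Fin 3 → ℝ) : ℝ :=
  ∑ i, ∑ j, u i * metric p i j * v j

/-- The Riemannian angle between the (nonzero) tangent vectors `u`, `v` at `p`. -/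
noncomputable def angle (p : Sol) (u v : Fin 3 → ℝ) : ℝ :=
  Real.arccos (metricInner p u v / Real.sqrt (metricInner p u u * metricInner p v v))

/-- A (nondegenerate) geodesic triangle of `Sol`: three different points `A_0, A_1, A_2` of `Sol`
that do not lie on a common geodesic, and for each `i` (modulo 3) a geodesic segment from `A_i` to
`A_(i+1)`, parametrized by `[0, 1]` as the restriction of the geodesic `side i`. -/
structure GeodesicTriangle where
  vertex : Fin 3 → Sol
  side : Fin 3 → ℝ → Sol
  vertex_injective : Function.Injective vertex
  not_collinear : ∀ γ : ℝ → Sol, IsGeodesic γ → ¬ ∀ i, vertex i ∈ Set.range γ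
  side_isGeodesic : ∀ i, IsGeodesic (side i)
  side_zero : ∀ i, side i 0 = vertex i
  side_one : ∀ i, side i 1 = vertex (i + 1)

/-- The interior angle `ω_i` at `A_i`: the angle between the tangent vectors at `A_i` of the two
sides that meet there, both oriented away from `A_i`. The side `i` starts at `A_i`, and the side
`i - 1 = i + 2` ends at `A_i`, so its velocity is reversed. -/
noncomputable def GeodesicTriangle.interiorAngle (T : GeodesicTriangle) (i : Fin 3) : ℝ :=
  angle (T.vertex i) (deriv (T.side i) 0) (-deriv (T.side (i + 2)) 1)

/-- The sum of the interior angles of a geodesic triangle. -/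
noncomputable def GeodesicTriangle.angleSum (T : GeodesicTriangle) : ℝ :=
  ∑ i, T.interiorAngle i

end SolGeometry

namespace SolGeometry

/-! One continuous family of triangles gives all three cases: the vertices are `(0, 0, 0)`, `(0, 1,
h)`, `(1, 1, 0)`. Its sides are explicit: two lie in the planes `x = 0` and `y = 1`, which are
hyperbolic half-planes where geodesics are semicircles, and the third is a straight segment in `z =
0`. Hence the angle sum is a closed expression in `e ^ (2 * h)` and `e ^ (-2 * h)`
(`exists_triangle`).

At `h = 0` the sum exceeds `π`. As `h → ∞` the angles tend to `π / 2`, `0`, `π / 4`, so a large `h`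
gives less than `π`; the intermediate value theorem gives equality in between. Nondegeneracy comes
from the conserved momentum of the translations in `x` (`IsGeodesic.x_const`). -/

/-! ### The geodesic equation in coordinates. -/

lemma hasDerivAt_apply {γ : ℝ → Sol} {t : ℝ} (h : DifferentiableAt ℝ γ t) (k : Fin 3) :
    HasDerivAt (fun s => γ s k) (deriv γ t k) t :=
  hasDerivAt_pi.1 h.hasDerivAt k

lemma metric_inv (p : Sol) :
    (metric p)⁻¹ = Matrix.diagonal ![Real.exp (-2 * p 2), Real.exp (2 * p 2), 1] := by
  refine Matrix.inv_eq_right_inv ?_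
  rw [metric, Matrix.diagonal_mul_diagonal, ← Matrix.diagonal_one]
  congr 1
  ext i
  fin_cases i <;> simp [← Real.exp_add]

lemma metricDeriv_eq (p : Sol) (i j l : Fin 3) :
    metricDeriv p i j l =
      if i = 2 ∧ j = l then ![2 * Real.exp (2 * p 2), -2 * Real.exp (-2 * p 2), 0] j else 0 := by
  have hz : HasFDerivAt (fun q : Sol => q 2) (ContinuousLinearMap.proj (R := ℝ) (2 : Fin 3)) p :=
    (ContinuousLinearMap.proj (R := ℝ) (φ := fun _ : Fin 3 => ℝ) (2 : Fin 3)).hasFDerivAt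
  unfold metricDeriv
  by_cases hjl : j = l
  · subst hjl
    have h1 := ((hz.const_mul 2).exp).fderiv
    have h2 := ((hz.const_mul (-2)).exp).fderiv
    fin_cases j
    · simp only [metric, Matrix.diagonal_apply_eq]
      simp only [Fin.zero_eta, Matrix.cons_val_zero]
      rw [h1]
      fin_cases i <;> simp [mul_comm]
    · simp only [metric, Matrix.diagonal_apply_eq]
      simp only [Fin.mk_one, Matrix.cons_val_one, Matrix.cons_val_zero]
      rw [h2]
      fin_cases i <;> simp [mul_comm]
    · simp [metric]
  · simp [metric, hjl]

/-- The geodesic equation of `Sol`, written out in coordinates. -/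
lemma isGeodesic_iff {γ : ℝ → Sol} : IsGeodesic γ ↔ ContDiff ℝ 2 γ ∧ ∀ t,
    deriv (deriv γ) t 0 + 2 * deriv γ t 2 * deriv γ t 0 = 0 ∧
    deriv (deriv γ) t 1 - 2 * deriv γ t 2 * deriv γ t 1 = 0 ∧
    deriv (deriv γ) t 2 - Real.exp (2 * γ t 2) * deriv γ t 0 ^ 2
      + Real.exp (-2 * γ t 2) * deriv γ t 1 ^ 2 = 0 := by
  refine and_congr_right fun _ => forall_congr' fun t => ?_
  have e : Real.exp (-2 * γ t 2) * Real.exp (2 * γ t 2) = 1 := by simp [← Real.exp_add]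
  generalize hE : Real.exp (2 * γ t 2) = E at *
  generalize hF : Real.exp (-2 * γ t 2) = F at *
  simp only [Fin.forall_fin_succ, Fin.sum_univ_three, christoffel, metric_inv, metricDeriv_eq,
    hE, hF]
  simp [Matrix.diagonal_apply]
  refine and_congr (Eq.congr ?_ rfl) (and_congr (Eq.congr ?_ rfl) (Eq.congr ?_ rfl))
  · linear_combination 2 * deriv γ t 0 * deriv γ t 2 * e
  · linear_combination -2 * deriv γ t 1 * deriv γ t 2 * e
  · ring

lemma hasDerivAt_vec {x y z x' y' z' : ℝ → ℝ} {t : ℝ} (hx : HasDerivAt x (x' t) t)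
    (hy : HasDerivAt y (y' t) t) (hz : HasDerivAt z (z' t) t) :
    HasDerivAt (fun s => (![x s, y s, z s] : Sol)) ![x' t, y' t, z' t] t := by
  rw [hasDerivAt_pi]
  intro i
  fin_cases i <;> simpa

lemma deriv_vec {x y z x' y' z' : ℝ → ℝ} (hx : ∀ t, HasDerivAt x (x' t) t)
    (hy : ∀ t, HasDerivAt y (y' t) t) (hz : ∀ t, HasDerivAt z (z' t) t) :
    deriv (fun s => (![x s, y s, z s] : Sol)) = fun t => ![x' t, y' t, z' t] :=
  funext fun t => (hasDerivAt_vec (hx t) (hy t) (hz t)).deriv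

lemma isGeodesic_vec {x y z x' y' z' x'' y'' z'' : ℝ → ℝ}
    (cx : ContDiff ℝ 2 x) (cy : ContDiff ℝ 2 y) (cz : ContDiff ℝ 2 z)
    (hx : ∀ t, HasDerivAt x (x' t) t) (hy : ∀ t, HasDerivAt y (y' t) t)
    (hz : ∀ t, HasDerivAt z (z' t) t) (hx' : ∀ t, HasDerivAt x' (x'' t) t)
    (hy' : ∀ t, HasDerivAt y' (y'' t) t) (hz' : ∀ t, HasDerivAt z' (z'' t) t)
    (ex : ∀ t, x'' t + 2 * z' t * x' t = 0) (ey : ∀ t, y'' t - 2 * z' t * y' t = 0)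
    (ez : ∀ t, z'' t - Real.exp (2 * z t) * x' t ^ 2 + Real.exp (-2 * z t) * y' t ^ 2 = 0) :
    IsGeodesic fun t => ![x t, y t, z t] := by
  refine isGeodesic_iff.2 ⟨contDiff_pi.2 fun i => ?_, fun t => ?_⟩
  · fin_cases i <;> simpa
  · rw [deriv_vec hx hy hz, deriv_vec hx' hy' hz']
    exact ⟨ex t, ey t, ez t⟩

/-! ### Explicit geodesics for the sides. -/

/-- Geodesics of the hyperbolic half-plane with metric `e ^ (-2 * g) * df ^ 2 + dg ^ 2`: the circle
with centre `(c, 0)` through `(y₀, w₀)` and `(y₁, w₁)` in the coordinates `(f, e ^ g)`. -/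
lemma exists_halfPlane_geodesic {y₀ y₁ w₀ w₁ c : ℝ} (hy : y₀ < y₁) (hw₀ : 0 < w₀) (hw₁ : 0 < w₁)
    (hc : (y₀ - c) ^ 2 + w₀ ^ 2 = (y₁ - c) ^ 2 + w₁ ^ 2) :
    ∃ f g f' g' f'' g'' : ℝ → ℝ, ∃ k : ℝ, 0 < k ∧ ContDiff ℝ 2 f ∧ ContDiff ℝ 2 g ∧
      (∀ t, HasDerivAt f (f' t) t) ∧ (∀ t, HasDerivAt g (g' t) t) ∧
      (∀ t, HasDerivAt f' (f'' t) t) ∧ (∀ t, HasDerivAt g' (g'' t) t) ∧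
      (∀ t, f'' t - 2 * g' t * f' t = 0) ∧
      (∀ t, g'' t + Real.exp (-2 * g t) * f' t ^ 2 = 0) ∧
      f 0 = y₀ ∧ f 1 = y₁ ∧ g 0 = Real.log w₀ ∧ g 1 = Real.log w₁ ∧
      f' 0 = k * w₀ ^ 2 ∧ f' 1 = k * w₁ ^ 2 ∧ g' 0 = k * (c - y₀) ∧ g' 1 = k * (c - y₁) := by
  obtain ⟨R, hR, hR0⟩ : ∃ R : ℝ, 0 < R ∧ R ^ 2 = (y₀ - c) ^ 2 + w₀ ^ 2 :=
    ⟨√((y₀ - c) ^ 2 + w₀ ^ 2), by positivity, Real.sq_sqrt (by positivity)⟩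
  -- The circle has the parametrization `(c + R tanh τ, R / cosh τ)`, with `τ` the arc length; this
  -- finds the `τ` of a given point.
  have key : ∀ y w : ℝ, 0 < w → R ^ 2 = (y - c) ^ 2 + w ^ 2 →
      ∃ τ, Real.sinh τ = (y - c) / w ∧ Real.cosh τ = R / w := by
    intro y w hw h
    refine ⟨Real.arsinh ((y - c) / w), Real.sinh_arsinh _, ?_⟩
    rw [Real.cosh_arsinh, Real.sqrt_eq_iff_mul_self_eq_of_pos (by positivity)]
    field_simp
    linarith
  obtain ⟨τ₀, hs₀, hc₀⟩ := key y₀ w₀ hw₀ hR0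
  obtain ⟨τ₁, hs₁, hc₁⟩ := key y₁ w₁ hw₁ (hR0.trans hc)
  have hτ : τ₀ < τ₁ := by
    have : 0 < Real.sinh (τ₁ - τ₀) := by
      rw [Real.sinh_sub, hs₀, hs₁, hc₀, hc₁]
      have : (y₁ - c) / w₁ * (R / w₀) - R / w₁ * ((y₀ - c) / w₀)
        = R * (y₁ - y₀) / (w₀ * w₁) := by field_simp; ring
      rw [this]
      have := sub_pos.2 hy
      positivity
    linarith [Real.sinh_pos_iff.1 this]
  have hΔ : 0 < τ₁ - τ₀ := sub_pos.2 hτ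
  generalize hD : τ₁ - τ₀ = Δ at hΔ
  have hτ₁ : τ₀ + 1 * Δ = τ₁ := by rw [← hD]; ring
  have hτ₀ : τ₀ + 0 * Δ = τ₀ := by ring
  have C : ∀ t, 0 < Real.cosh (τ₀ + t * Δ) := fun t => Real.cosh_pos _
  have C' : ∀ t, Real.cosh (τ₀ + t * Δ) ≠ 0 := fun t => (C t).ne'
  have D : ∀ t, HasDerivAt (fun t => τ₀ + t * Δ) Δ t := fun t => by
    simpa using ((hasDerivAt_id t).mul_const Δ).const_add τ₀
  have Dc := fun t => (D t).cosh
  have Ds := fun t => (D t).sinh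
  have S : ∀ t, Real.sinh (τ₀ + t * Δ) ^ 2 = Real.cosh (τ₀ + t * Δ) ^ 2 - 1 := fun t => by
    rw [Real.cosh_sq]; ring
  -- Rescaling `τ` affinely puts the endpoints at `t = 0` and `t = 1`; the speed is `Δ`, whence `k =
  -- Δ / R`.
  refine ⟨fun t => c + R * (Real.sinh (τ₀ + t * Δ) / Real.cosh (τ₀ + t * Δ)),
    fun t => Real.log (R / Real.cosh (τ₀ + t * Δ)),
    fun t => R * Δ / Real.cosh (τ₀ + t * Δ) ^ 2,
    fun t => -Δ * (Real.sinh (τ₀ + t * Δ) / Real.cosh (τ₀ + t * Δ)),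
    fun t => -2 * R * Δ ^ 2 * Real.sinh (τ₀ + t * Δ) / Real.cosh (τ₀ + t * Δ) ^ 3,
    fun t => -Δ ^ 2 / Real.cosh (τ₀ + t * Δ) ^ 2, Δ / R, by positivity, ?_, ?_,
    fun t => ?_, fun t => ?_, fun t => ?_, fun t => ?_, fun t => ?_, fun t => ?_,
    ?_, ?_, ?_, ?_, ?_, ?_, ?_, ?_⟩
  · exact contDiff_const.add (contDiff_const.mul (ContDiff.div (by fun_prop) (by fun_prop) C'))
  · exact ContDiff.log (contDiff_const.div (by fun_prop) C') fun t => (div_pos hR (C t)).ne'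
  · refine ((((Ds t).fun_div (Dc t) (C' t)).const_mul R).const_add c).congr_deriv ?_
    have h := C' t
    have hS := S t
    beta_reduce
    generalize Real.cosh (τ₀ + t * Δ) = C at *
    generalize Real.sinh (τ₀ + t * Δ) = S at *
    field_simp
    linear_combination -hS
  · refine (((hasDerivAt_const t R).fun_div (Dc t) (C' t)).log (div_pos hR (C t)).ne').congr_deriv ?_
    have := C' t
    field_simp
    ring
  · refine ((hasDerivAt_const t (R * Δ)).fun_div ((Dc t).fun_pow 2)
      (pow_ne_zero 2 (C' t))).congr_deriv ?_
    have := C' t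
    field_simp
    ring
  · refine (((Ds t).fun_div (Dc t) (C' t)).const_mul (-Δ)).congr_deriv ?_
    have h := C' t
    have hS := S t
    beta_reduce
    generalize Real.cosh (τ₀ + t * Δ) = C at *
    generalize Real.sinh (τ₀ + t * Δ) = S at *
    field_simp
    linear_combination hS
  · have := C' t
    field_simp
    ring
  · have h : Real.exp (-2 * Real.log (R / Real.cosh (τ₀ + t * Δ)))
        = (Real.cosh (τ₀ + t * Δ) / R) ^ 2 := by
      rw [show -2 * Real.log (R / Real.cosh (τ₀ + t * Δ))
        = Real.log ((Real.cosh (τ₀ + t * Δ) / R) ^ 2) by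
          rw [Real.log_pow, ← inv_div, Real.log_inv]; push_cast; ring,
        Real.exp_log (pow_pos (div_pos (C t) hR) 2)]
    simp only [h]
    have := C' t
    field_simp
    ring
  all_goals
    simp only [hτ₀, hτ₁, hs₀, hs₁, hc₀, hc₁]
    field_simp
    try ring_nf

/-- With `x' = 0` the geodesic equation reduces to that of the half-plane with `w = e ^ z`. The
positive factor `k` is left unspecified because angles do not see it. -/
lemma exists_geodesic_x_const (x₀ : ℝ) {y₀ y₁ w₀ w₁ c : ℝ} (hy : y₀ < y₁) (hw₀ : 0 < w₀)
    (hw₁ : 0 < w₁) (hc : (y₀ - c) ^ 2 + w₀ ^ 2 = (y₁ - c) ^ 2 + w₁ ^ 2) :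
    ∃ γ, IsGeodesic γ ∧ γ 0 = ![x₀, y₀, Real.log w₀] ∧ γ 1 = ![x₀, y₁, Real.log w₁] ∧
      ∃ k : ℝ, 0 < k ∧ deriv γ 0 = k • ![0, w₀ ^ 2, c - y₀] ∧
        deriv γ 1 = k • ![0, w₁ ^ 2, c - y₁] := by
  obtain ⟨f, g, f', g', f'', g'', k, hk, cf, cg, hf, hg, hf', hg', e₁, e₂, f0, f1, g0, g1, a0, a1,
    b0, b1⟩ := exists_halfPlane_geodesic hy hw₀ hw₁ hc
  refine ⟨fun t => ![x₀, f t, g t],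
    isGeodesic_vec (x'' := fun _ => 0) contDiff_const cf cg (fun t => hasDerivAt_const t x₀) hf hg
      (fun t => hasDerivAt_const t 0) hf' hg' (fun t => by simp) e₁ (fun t => by simpa using e₂ t),
    by simp [f0, g0], by simp [f1, g1], k, hk, ?_, ?_⟩ <;>
  simp [deriv_vec (fun t => hasDerivAt_const t x₀) hf hg, a0, a1, b0, b1]

/-- The isometry `(x, y, z) ↦ (y, x, -z)` exchanges the two kinds of planes, so here `w = e ^ (-z)`.
-/
lemma exists_geodesic_y_const (y₀ : ℝ) {x₀ x₁ w₀ w₁ c : ℝ} (hx : x₀ < x₁) (hw₀ : 0 < w₀)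
    (hw₁ : 0 < w₁) (hc : (x₀ - c) ^ 2 + w₀ ^ 2 = (x₁ - c) ^ 2 + w₁ ^ 2) :
    ∃ γ, IsGeodesic γ ∧ γ 0 = ![x₀, y₀, -Real.log w₀] ∧ γ 1 = ![x₁, y₀, -Real.log w₁] ∧
      ∃ k : ℝ, 0 < k ∧ deriv γ 0 = k • ![w₀ ^ 2, 0, x₀ - c] ∧
        deriv γ 1 = k • ![w₁ ^ 2, 0, x₁ - c] := by
  obtain ⟨f, g, f', g', f'', g'', k, hk, cf, cg, hf, hg, hf', hg', e₁, e₂, f0, f1, g0, g1, a0, a1,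
    b0, b1⟩ := exists_halfPlane_geodesic hx hw₀ hw₁ hc
  refine ⟨fun t => ![f t, y₀, -g t],
    isGeodesic_vec (y'' := fun _ => 0) cf contDiff_const cg.neg hf (fun t => hasDerivAt_const t y₀)
      (fun t => (hg t).neg) hf' (fun t => hasDerivAt_const t 0) (fun t => (hg' t).neg)
      (fun t => by linarith [e₁ t]) (fun t => by simp)
      (fun t => by have := e₂ t; simp at this ⊢; linarith),
    by simp [f0, g0], by simp [f1, g1], k, hk, ?_, ?_⟩
  all_goals
    rw [deriv_vec (z := fun t => -g t) (z' := fun t => -g' t) hf (fun t => hasDerivAt_const t y₀)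
      fun t => (hg t).neg]
    simp [a0, a1, b0, b1]
    ring

/-- At `z = 0` the two quadratic terms of the `z`-equation cancel when `x' ^ 2 = y' ^ 2`. -/
lemma isGeodesic_diagonal : IsGeodesic fun t => ![1 - t, 1 - t, 0] := by
  have h : ∀ t : ℝ, HasDerivAt (fun t => 1 - t) (-1) t := fun t => (hasDerivAt_id t).const_sub 1
  refine isGeodesic_vec (x' := fun _ => -1) (y' := fun _ => -1) (z' := fun _ => 0)
    (x'' := fun _ => 0) (y'' := fun _ => 0) (z'' := fun _ => 0)
    (by fun_prop) (by fun_prop) (by fun_prop) h h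
    (fun t => hasDerivAt_const t 0) (fun t => hasDerivAt_const t _) (fun t => hasDerivAt_const t _)
    (fun t => hasDerivAt_const t 0) ?_ ?_ ?_ <;> simp

lemma deriv_diagonal (t : ℝ) : deriv (fun t => (![1 - t, 1 - t, 0] : Sol)) t = ![-1, -1, 0] := by
  have h : ∀ t : ℝ, HasDerivAt (fun t => 1 - t) (-1) t := fun t => (hasDerivAt_id t).const_sub 1
  exact congrFun (deriv_vec (x' := fun _ => -1) (y' := fun _ => -1) (z' := fun _ => 0) h h
    fun t => hasDerivAt_const t 0) t

/-! ### Conserved momentum. -/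

/-- `e ^ (2 * z) * x'` is constant along a geodesic. -/
lemma IsGeodesic.exists_deriv_x_eq {γ : ℝ → Sol} (hγ : IsGeodesic γ) :
    ∃ a, ∀ t, Real.exp (2 * γ t 2) * deriv γ t 0 = a := by
  obtain ⟨hC, he⟩ := isGeodesic_iff.1 hγ
  have h1 : Differentiable ℝ γ := hC.differentiable (by norm_num)
  have h2 : Differentiable ℝ (deriv γ) :=
    (hC.iterate_deriv' 1 1).differentiable (by norm_num)
  refine ⟨_, fun t => is_const_of_deriv_eq_zero (f := fun t => Real.exp (2 * γ t 2) * deriv γ t 0)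
    ?_ ?_ t 0⟩
  · exact fun t => ((((hasDerivAt_apply (h1 t) 2).const_mul 2).exp).mul
      (hasDerivAt_apply (h2 t) 0)).differentiableAt
  · intro t
    refine ((((hasDerivAt_apply (h1 t) 2).const_mul 2).exp).mul
      (hasDerivAt_apply (h2 t) 0)).deriv.trans ?_
    linear_combination Real.exp (2 * γ t 2) * (he t).1

/-- A geodesic that meets a plane `x = const` in two points stays in it. -/
lemma IsGeodesic.x_const {γ : ℝ → Sol} (hγ : IsGeodesic γ) {s t : ℝ} (hst : s < t)
    (h : γ s 0 = γ t 0) (u : ℝ) : γ u 0 = γ s 0 := by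
  have h1 : Differentiable ℝ γ := hγ.1.differentiable (by norm_num)
  obtain ⟨a, ha⟩ := hγ.exists_deriv_x_eq
  have hd : ∀ t, deriv (fun t => γ t 0) t = deriv γ t 0 := fun t => (hasDerivAt_apply (h1 t) 0).deriv
  have hdiff : Differentiable ℝ (fun t => γ t 0) :=
    fun t => (hasDerivAt_apply (h1 t) 0).differentiableAt
  -- By Rolle `x'` vanishes somewhere, so the conserved momentum is zero and `x'` vanishes
  -- everywhere.
  obtain ⟨r, -, hr⟩ := exists_deriv_eq_zero hst hdiff.continuous.continuousOn h
  have ha0 : a = 0 := by rw [← ha r, ← hd, hr, mul_zero]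
  refine is_const_of_deriv_eq_zero hdiff (fun v => ?_) u s
  have := ha v
  rw [ha0, mul_eq_zero] at this
  rw [hd]
  exact this.resolve_left (Real.exp_pos _).ne'

/-! ### Angles and the family of triangles. -/

lemma metricInner_eq (p : Sol) (u v : Fin 3 → ℝ) : metricInner p u v =
    Real.exp (2 * p 2) * u 0 * v 0 + Real.exp (-2 * p 2) * u 1 * v 1 + u 2 * v 2 := by
  simp [metricInner, metric, Fin.sum_univ_three, Matrix.diagonal_apply]
  ring

lemma angle_smul_smul (p : Sol) (u v : Fin 3 → ℝ) {k l : ℝ} (hk : 0 < k) (hl : 0 < l) :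
    angle p (k • u) (l • v) = angle p u v := by
  have h : ∀ (a b : ℝ) (x y : Fin 3 → ℝ),
      metricInner p (a • x) (b • y) = a * b * metricInner p x y := fun a b x y => by
    simp [metricInner_eq]
    ring
  have hkl : 0 < k * l := mul_pos hk hl
  unfold angle
  rw [h, h, h, show k * k * metricInner p u u * (l * l * metricInner p v v)
    = (k * l) ^ 2 * (metricInner p u u * metricInner p v v) by ring,
    Real.sqrt_mul (sq_nonneg _), Real.sqrt_sq hkl.le, mul_div_mul_left _ _ hkl.ne']

/-- The angle sum of the geodesic triangle with vertices `(0, 0, 0)`, `(0, 1, h)`, `(1, 1, 0)`,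
where `a = e ^ (2 * h)` and `b = e ^ (-2 * h)`. -/
noncomputable def angleSumFormula (a b : ℝ) : ℝ :=
  Real.arccos (1 / √((1 + (a / 2) ^ 2) * 2)) +
    Real.arccos (-((1 - a / 2) * (1 - b / 2)) / √((1 + (b / 2) ^ 2) * (1 + (a / 2) ^ 2))) +
    Real.arccos (1 / √(2 * (1 + (b / 2) ^ 2)))

lemma exists_triangle (h : ℝ) : ∃ T : GeodesicTriangle,
    T.angleSum = angleSumFormula (Real.exp (2 * h)) (Real.exp (-2 * h)) := by
  have ha : Real.exp h ^ 2 = Real.exp (2 * h) := by rw [← Real.exp_nat_mul]; norm_num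
  have hb : Real.exp (-h) ^ 2 = Real.exp (-2 * h) := by rw [← Real.exp_nat_mul]; norm_num
  have hab : Real.exp (2 * h) * Real.exp (-2 * h) = 1 := by simp [← Real.exp_add]
  -- Each centre `c` solves the linear equation saying that it is equidistant from the two
  -- endpoints.
  obtain ⟨γ, hγ, γ0, γ1, k, hk, dγ0, dγ1⟩ := exists_geodesic_x_const 0 (c := Real.exp (2 * h) / 2)
    zero_lt_one zero_lt_one (Real.exp_pos h) (by rw [ha]; ring)
  obtain ⟨δ, hδ, δ0, δ1, l, hl, dδ0, dδ1⟩ := exists_geodesic_y_const 1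
    (c := 1 - Real.exp (-2 * h) / 2) zero_lt_one (Real.exp_pos (-h)) zero_lt_one (by rw [hb]; ring)
  simp only [Real.log_exp, Real.log_one, neg_neg, neg_zero, ha, hb] at γ0 γ1 δ0 δ1 dγ1 dδ0
  let T : GeodesicTriangle :=
    { vertex := ![![0, 0, 0], ![0, 1, h], ![1, 1, 0]]
      side := ![γ, δ, fun t => ![1 - t, 1 - t, 0]]
      vertex_injective := by
        intro i j hij
        have h0 := congrFun hij 0
        have h1 := congrFun hij 1
        fin_cases i <;> fin_cases j <;> simp at h0 h1 ⊢
      not_collinear := by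
        intro σ hσ hmem
        obtain ⟨r, hr⟩ := hmem 0
        obtain ⟨s, hs⟩ := hmem 1
        obtain ⟨t, ht⟩ := hmem 2
        have hrs : r ≠ s := by
          rintro rfl
          simpa using congrFun (hr.symm.trans hs) 1
        have hx : σ r 0 = 0 ∧ σ s 0 = 0 ∧ σ t 0 = 1 := by simp [hr, hs, ht]
        obtain ⟨xr, xs, xt⟩ := hx
        rcases hrs.lt_or_gt with hlt | hlt
        -- Meeting `x = 0` twice would confine the geodesic to that plane, which misses the third
        -- vertex.
        · linarith [hσ.x_const hlt (xr.trans xs.symm) t]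
        · linarith [hσ.x_const hlt (xs.trans xr.symm) t]
      side_isGeodesic := by
        simpa [Fin.forall_fin_succ] using ⟨hγ, hδ, isGeodesic_diagonal⟩
      side_zero := by simp [Fin.forall_fin_succ, γ0, δ0]
      side_one := by
        intro i
        fin_cases i
        · exact γ1
        · exact δ1
        · simp }
  have e0 : T.interiorAngle 0 = angle ![0, 0, 0] (k • ![0, 1 ^ 2, Real.exp (2 * h) / 2 - 0])
      ((1 : ℝ) • ![1, 1, 0]) := by
    rw [← dγ0, show (1 : ℝ) • ![1, 1, 0] = -(![-1, -1, 0] : Fin 3 → ℝ) by simp,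
      ← deriv_diagonal 1]
    rfl
  have e1 : T.interiorAngle 1 = angle ![0, 1, h]
      (l • ![Real.exp (-2 * h), 0, 0 - (1 - Real.exp (-2 * h) / 2)])
      (k • -![0, Real.exp (2 * h), Real.exp (2 * h) / 2 - 1]) := by
    rw [← dδ0, smul_neg, ← dγ1]
    rfl
  have e2 : T.interiorAngle 2 = angle ![1, 1, 0] ((1 : ℝ) • ![-1, -1, 0])
      (l • -![1 ^ 2, 0, 1 - (1 - Real.exp (-2 * h) / 2)]) := by
    rw [smul_neg, ← dδ1, one_smul, ← deriv_diagonal 0]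
    rfl
  refine ⟨T, ?_⟩
  rw [GeodesicTriangle.angleSum, Fin.sum_univ_three, e0, e1, e2, angle_smul_smul _ _ _ hk one_pos,
    angle_smul_smul _ _ _ hl hk, angle_smul_smul _ _ _ one_pos hl, angleSumFormula]
  congr 1
  · congr 1
    · simp [angle, metricInner_eq, sq, one_add_one_eq_two]
    · simp only [angle, metricInner_eq, Matrix.cons_val, Pi.neg_apply]
      generalize Real.exp (2 * h) = a at *
      generalize Real.exp (-2 * h) = b at *
      congr 3
      · ring
      · congr 1
        -- As `a * b = 1`, the squared length is `a * b ^ 2 + (1 - b / 2) ^ 2 = 1 + (b / 2) ^ 2`;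
        -- likewise with `a` and `b` exchanged.
        · linear_combination b * hab
        · linear_combination a * hab
  · simp [angle, metricInner_eq, sq, one_add_one_eq_two]

/-! ### Continuity and the two extreme cases. -/

lemma continuous_angleSumFormula :
    Continuous fun h : ℝ => angleSumFormula (Real.exp (2 * h)) (Real.exp (-2 * h)) := by
  unfold angleSumFormula
  refine ((Real.continuous_arccos.comp (Continuous.div (by fun_prop) (by fun_prop) ?_)).add
    (Real.continuous_arccos.comp (Continuous.div (by fun_prop) (by fun_prop) ?_))).add
    (Real.continuous_arccos.comp (Continuous.div (by fun_prop) (by fun_prop) ?_)) <;>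
  exact fun h => by positivity

/-- The two equal angles are at least `π / 4`, and the one at `(0, 1, 0)` is obtuse. -/
lemma pi_lt_angleSumFormula : Real.pi < angleSumFormula 1 1 := by
  have h1 : Real.pi / 4 ≤ Real.arccos (1 / √(5 / 2)) := by
    rw [← Real.arccos_cos (x := Real.pi / 4) (by positivity) (by linarith [Real.pi_pos]),
      Real.cos_pi_div_four]
    refine Real.arccos_le_arccos ?_
    rw [Real.sqrt_div_self, ← one_div]
    exact one_div_le_one_div_of_le (by positivity) (Real.sqrt_le_sqrt (by norm_num))
  have h2 : Real.pi / 2 < Real.arccos (-(1 / 4) / √(25 / 16)) := by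
    rw [← not_le, Real.arccos_le_pi_div_two, not_le]
    exact div_neg_of_neg_of_pos (by norm_num) (by positivity)
  unfold angleSumFormula
  norm_num at h1 h2 ⊢
  linarith

/-- The value `100` is large enough for the bounds `π / 2`, `π / 6`, `π / 3`, which add up to `π`;
the first is strict. -/
lemma angleSumFormula_lt_pi : angleSumFormula 100 (1 / 100) < Real.pi := by
  have h1 : Real.arccos (1 / √((1 + (100 / 2) ^ 2) * 2)) < Real.pi / 2 :=
    Real.arccos_lt_pi_div_two.2 (by positivity)
  have h2 : Real.arccos (-((1 - 100 / 2) * (1 - 1 / 100 / 2)) /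
      √((1 + (1 / 100 / 2) ^ 2) * (1 + (100 / 2) ^ 2))) ≤ Real.pi / 6 := by
    rw [← Real.arccos_cos (x := Real.pi / 6) (by positivity) (by linarith [Real.pi_pos])]
    rw [Real.cos_pi_div_six]
    refine Real.arccos_le_arccos ?_
    rw [le_div_iff₀ (by positivity),
      ← pow_le_pow_iff_left₀ (by positivity) (by norm_num) two_ne_zero, mul_pow, div_pow,
      Real.sq_sqrt (by positivity), Real.sq_sqrt (by positivity)]
    norm_num
  have h3 : Real.arccos (1 / √(2 * (1 + (1 / 100 / 2) ^ 2))) ≤ Real.pi / 3 := by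
    rw [← Real.arccos_cos (x := Real.pi / 3) (by positivity) (by linarith [Real.pi_pos])]
    rw [Real.cos_pi_div_three]
    refine Real.arccos_le_arccos ?_
    rw [le_div_iff₀ (by positivity),
      ← pow_le_pow_iff_left₀ (by positivity) (by norm_num) two_ne_zero, mul_pow,
      Real.sq_sqrt (by positivity)]
    norm_num
  unfold angleSumFormula
  linarith

end SolGeometry

open SolGeometry in
theorem mainTheorem1 :
    (∃ T : SolGeometry.GeodesicTriangle, Real.pi < T.angleSum) ∧
    (∃ T : SolGeometry.GeodesicTriangle, T.angleSum < Real.pi) ∧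
    (∃ T : SolGeometry.GeodesicTriangle, T.angleSum = Real.pi) := by
  have h0 : Real.pi < angleSumFormula (Real.exp (2 * 0)) (Real.exp (-2 * 0)) := by
    simpa using pi_lt_angleSumFormula
  have h1 : angleSumFormula (Real.exp (2 * (Real.log 100 / 2)))
      (Real.exp (-2 * (Real.log 100 / 2))) < Real.pi := by
    rw [show 2 * (Real.log 100 / 2) = Real.log 100 by ring,
      show -2 * (Real.log 100 / 2) = -Real.log 100 by ring, Real.exp_neg,
      Real.exp_log (by norm_num), ← one_div]
    exact angleSumFormula_lt_pi
  obtain ⟨h, hh⟩ := mem_range_of_exists_le_of_exists_ge continuous_angleSumFormula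
    ⟨_, h1.le⟩ ⟨_, h0.le⟩
  obtain ⟨T₀, hT₀⟩ := exists_triangle 0
  obtain ⟨T₁, hT₁⟩ := exists_triangle (Real.log 100 / 2)
  obtain ⟨T, hT⟩ := exists_triangle h
  exact ⟨⟨T₀, hT₀ ▸ h0⟩, ⟨T₁, hT₁ ▸ h1⟩, ⟨T, hT.trans hh⟩⟩
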